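/- Let $n\ge 0$ and let $\lambda$ be a partition of $n+1$ with conjugate $\lambda'$. Write $\mathrm{Tab}(\lambda,\mu)$ for the set of semistandard Young tableaux of shape $\lambda$ in which the letter $i$ occurs $\mu_i$ times, and $K_{\lambda\mu}=|\mathrm{Tab}(\lambda,\mu)|$ for the Kostka number. For $1\le i\le n$, let $\epsilon_i$ and $\phi_i$ be the crystal operators on words with letters in $\{1,\dots,n+1\}$: in the subword of a word $w$ formed by its letters $i$ and $i+1$, bracket successively the factors $(i+1)\,i$, ignoring letters already bracketed, until the unbracketed letters form a subword $i^r(i+1)^s$; then $\epsilon_i$ replaces it by $i^{r+1}(i+1)^{s-1}$ (and $\epsilon_i(w)=0$ if $s=0$), and $\phi_i$ replaces it by $i^{r-1}(i+1)^{s+1}$ (and $\phi_i(w)=0$ if $r=0$), all other letters being unchanged. A tableau $t$ is identified with its row reading (rows read from left to right, from the shortest row, which contains the largest entry of the first column, to the longest row), and its exponent in direction $i$ is $$d_i(t)=\min\bigl\{\max\{k:\epsilon_i^k(t)\neq 0\},\ \max\{k:\phi_i^k(t)\neq 0\}\bigr\}.$$ Put $$\mathbf K_{\lambda,(1^{n+1})}(x_1,\dots,x_n)=\sum_{t\in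 \mathrm{Tab}(\lambda,(1^{n+1}))}\ \prod_{i=1}^n x_i^{d_i(t)},\qquad t_i=\frac{x_i}{1-x_i}\quad(1\le i\le n).$$ Then, in the field $\mathbb Q(x_1,\dots,x_n)$, $$\frac{\mathbf K_{\lambda,(1^{n+1})}(x_1,\dots,x_n)}{\prod_{i=1}^n(1-x_i)}=\sum_{\mu\vdash n+1}K_{\lambda'\mu}\sum_{I\in \mathbf S(\mu)}t_{i_1}\,t_{i_1+i_2}\cdots t_{i_1+\cdots+i_{r-1}},$$ where for $\mu=(\mu_1,\dots,\mu_r)$ with positive parts, $\mathbf S(\mu)$ is the set of all (distinct) compositions $I=(i_1,\dots,i_r)$ obtained by permuting the parts of $\mu$; for $r=1$ the product is empty and equals $1$. -/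

import Mathlib

/-!
Conventions.  The ordered alphabet `a_1 < a_2 < ⋯` is encoded by `ℕ`: the letter `a_{j+1}` is the
natural number `j`.  Likewise the variable `x_{i+1}` (`0 ≤ i < n`) is `MvPolynomial.X i` with
`i : Fin n`, and the operators attached to the letters `a_{i+1} < a_{i+2}` (encoded by
`i < i + 1`) carry the index `i`.
Partitions used as shapes are Young diagrams, in matrix coordinates (row `0` is the longest one).
-/

noncomputable section

namespace CrystalKostka

/-! ### Tableaux of given shape and weight -/

/-- `Tab(lam, wt)`: semistandard tableaux of shape `lam` in which each letter `j` occurs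
exactly `wt j` times. -/
def tab (lam : YoungDiagram) (wt : ℕ → ℕ) : Set (SemistandardYoungTableau lam) :=
  {T | ∀ j, (lam.cells.filter fun c => T c.1 c.2 = j).card = wt j}

theorem tab_finite (lam : YoungDiagram) (wt : ℕ → ℕ) : (tab lam wt).Finite := by
  rcases (tab lam wt).eq_empty_or_nonempty with h | ⟨T₀, h₀⟩
  · rw [h]; exact Set.finite_empty
  · have key : ∀ T ∈ tab lam wt, ∀ c : lam.cells,
        T c.1.1 c.1.2 ∈ lam.cells.image fun c => T₀ c.1 c.2 := by
      intro T hT c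
      have h1 : 0 < wt (T c.1.1 c.1.2) := by
        rw [← hT]
        exact Finset.card_pos.2 ⟨c.1, Finset.mem_filter.2 ⟨c.2, rfl⟩⟩
      rw [← h₀] at h1
      obtain ⟨d, hd⟩ := Finset.card_pos.1 h1
      rw [Finset.mem_filter] at hd
      exact Finset.mem_image.2 ⟨d, hd.1, hd.2⟩
    let F : tab lam wt → (lam.cells → (lam.cells.image fun c => T₀ c.1 c.2)) :=
      fun T c => ⟨T.1 c.1.1 c.1.2, key T.1 T.2 c⟩
    have hF : Function.Injective F := by
      intro T T' h
      apply Subtype.ext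
      apply SemistandardYoungTableau.ext
      intro i j
      by_cases hc : (i, j) ∈ lam
      · exact congrArg Subtype.val (congrFun h ⟨(i, j), hc⟩)
      · rw [T.1.zeros hc, T'.1.zeros hc]
    exact Finite.of_injective F hF

/-- The Kostka number: the number of tableaux of shape `lam` and weight `wt`. -/
def kostka (lam : YoungDiagram) (wt : ℕ → ℕ) : ℕ :=
  (tab_finite lam wt).toFinset.card

/-- The weight `(k^m)`: each of the first `m` letters occurs `k` times, the others do not occur. -/
def rectWeight (k m : ℕ) : ℕ → ℕ := fun j => if j < m then k else 0

/-- A partition `μ = (μ_1 ≥ μ_2 ≥ ⋯)` as a weight: `j ↦ μ_{j+1}`, and `0` beyond the last part. -/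
def partWeight {m : ℕ} (mu : Nat.Partition m) : ℕ → ℕ :=
  fun j => (mu.parts.sort (· ≥ ·)).getD j 0

/-! ### The crystal operators on words -/

/-- One step of the bracketing of the factors `(i+1) i`, reading a word from left to right.  The
state consists of the positions of the letters `i` that have no partner and of the positions
of the letters `i + 1` that have no partner yet, both with the most recent position first: a letter
`i` is bracketed with the closest free letter `i + 1` on its left, if there is one. -/
def bracketStep (i : ℕ) (s : List ℕ × List ℕ) (x : ℕ × ℕ) : List ℕ × List ℕ :=
  if x.1 = i + 1 then (s.1, x.2 :: s.2)
  else if x.1 = i then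
    match s.2 with
    | [] => (x.2 :: s.1, [])
    | _ :: hi => (s.1, hi)
  else s

/-- The positions, from right to left, of the unbracketed letters `i` (first component) and of
the unbracketed letters `i + 1` (second component) of the word `w`; the unbracketed letters form
the subword `i^r (i+1)^s`. -/
def unbracketed (i : ℕ) (w : List ℕ) : List ℕ × List ℕ :=
  w.zipIdx.foldl (bracketStep i) ([], [])

/-- The raising operator: the subword `i^r (i+1)^s` of unbracketed letters becomes
`i^(r+1) (i+1)^(s-1)`; the value is `none` (that is, `0`) if `s = 0`. -/
def epsOp (i : ℕ) (w : List ℕ) : Option (List ℕ) :=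
  (unbracketed i w).2.getLast?.map fun p => w.set p i

/-- The lowering operator: the subword `i^r (i+1)^s` of unbracketed letters becomes
`i^(r-1) (i+1)^(s+1)`; the value is `none` (that is, `0`) if `r = 0`. -/
def phiOp (i : ℕ) (w : List ℕ) : Option (List ℕ) :=
  (unbracketed i w).1.head?.map fun p => w.set p (i + 1)

/-- The `k`-th power of a partially defined operator on words (`none` stands for `0`). -/
def opPow (f : List ℕ → Option (List ℕ)) (k : ℕ) (w : List ℕ) : Option (List ℕ) :=
  (fun o : Option (List ℕ) => o.bind f)^[k] (some w)

/-- `max {k | f^k w ≠ 0}`. -/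
def maxPow (f : List ℕ → Option (List ℕ)) (w : List ℕ) : ℕ :=
  sSup {k | opPow f k w ≠ none}

/-- The row reading of a tableau: the rows are read from left to right, starting with the
shortest row (the one with the largest index) and ending with the longest one. -/
def rowReading {lam : YoungDiagram} (T : SemistandardYoungTableau lam) : List ℕ :=
  (List.range (lam.colLen 0)).reverse.flatMap fun i => (List.range (lam.rowLen i)).map (T i)

/-- The exponent of `T` in direction `i`: the distance from `T` to the nearest end of its string of
colour `i` in the crystal graph. -/
def exponent (i : ℕ) {lam : YoungDiagram} (T : SemistandardYoungTableau lam) : ℕ :=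
  min (maxPow (epsOp i) (rowReading T)) (maxPow (phiOp i) (rowReading T))

/-- The polynomial `K_{lam,(k^{n+1})}(x_1, …, x_n)`, the sum over the tableaux of shape `lam` and
weight `(k^{n+1})` of the monomials `∏ x_i ^ d_i(T)`. -/
def multiKostka (n k : ℕ) (lam : YoungDiagram) : MvPolynomial (Fin n) ℚ :=
  ∑ T ∈ (tab_finite lam (rectWeight k (n + 1))).toFinset,
    ∏ i : Fin n, MvPolynomial.X i ^ exponent (i : ℕ) T

/-! ### Partial sums of compositions, and the variables `t_i` -/

theorem partialSum_lt {n : ℕ} (I : Composition (n + 1)) (k : Fin (I.length - 1)) :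
    0 < I.sizeUpTo (k + 1) ∧ I.sizeUpTo (k + 1) < n + 1 := by
  have hk := k.2
  have h1 : I.sizeUpTo k < I.sizeUpTo (k + 1) := I.sizeUpTo_strict_mono (by omega)
  have h2 : I.sizeUpTo (k + 1) < I.sizeUpTo (k + 1 + 1) := I.sizeUpTo_strict_mono (by omega)
  have h3 := I.sizeUpTo_le (k + 1 + 1)
  omega

/-- For a composition `I = (i_1, …, i_r)` of `n + 1` and `0 ≤ k < r - 1`, the partial sum
`d = i_1 + ⋯ + i_{k+1}` lies in `{1, …, n}`; this is the corresponding index, i.e. the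
element `d - 1` of `Fin n`. -/
def partialSumIdx {n : ℕ} (I : Composition (n + 1)) (k : Fin (I.length - 1)) : Fin n :=
  ⟨I.sizeUpTo (k + 1) - 1, by have := partialSum_lt I k; omega⟩

/-- The field of rational functions `ℚ(x_1, …, x_n)`. -/
abbrev RatFun (n : ℕ) : Type := FractionRing (MvPolynomial (Fin n) ℚ)

/-- The variable `x_{i+1}` as a rational function. -/
def ratX {n : ℕ} (i : Fin n) : RatFun n :=
  algebraMap (MvPolynomial (Fin n) ℚ) (RatFun n) (MvPolynomial.X i)

/-- `t_{i+1} = x_{i+1} / (1 - x_{i+1})`. -/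
def ratT {n : ℕ} (i : Fin n) : RatFun n := ratX i / (1 - ratX i)

/-- `S(mu)`: all the compositions obtained by permuting the parts of `mu`. -/
def rearrangements {m : ℕ} (mu : Nat.Partition m) : Finset (Composition m) :=
  Finset.univ.filter fun I => (I.blocks : Multiset ℕ) = mu.parts

end CrystalKostka

end

/-! ### Standard tableaux: exponents and descents. -/

noncomputable section
namespace CrystalKostka

/-! ### Exponents of words in which two adjacent letters occur once -/

/-! In a standard tableau the letters `i` and `i + 1` each occur once. Read in the order `i`, `i +
1` they stay unbracketed and the exponent is 1; read in the other order they cancel and it is 0,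
which happens exactly when `i` is a descent (`exponent_eq_ite`). After division by `1 - x_i`, a
non-descent contributes `t_i` and a descent `1 / (1 - x_i) = t_i + 1`. Expanding the product over
`i` gives a sum over subsets `S` of `∏ i ∈ S, t_i`, with coefficient the number of standard tableaux
for which every `i ∉ S` is a descent (`multiKostka_div_eq_sum`).

The set `S` cuts the alphabet into intervals. Replacing letters by their intervals and transposing
turns these standard tableaux into semistandard tableaux of the conjugate shape, weighted by the
interval lengths; standardization is the inverse (`card_descentsInBlocks`). So the coefficient is a
Kostka number indexed by a composition. Partial sums match compositions with subsets
(`partialSums_bijective`), and the Bender–Knuth involution shows that the Kostka number depends only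
on the sorted composition (`kostka_getD_of_perm`). -/

theorem foldl_bracketStep_of_forall_ne {i : ℕ} (l : List (ℕ × ℕ)) (s : List ℕ × List ℕ)
    (h : ∀ x ∈ l, x.1 ≠ i ∧ x.1 ≠ i + 1) : l.foldl (bracketStep i) s = s := by
  induction l with
  | nil => rfl
  | cons x l ih =>
    have hx := h x (by simp)
    rw [List.foldl_cons, bracketStep, if_neg hx.2, if_neg hx.1]
    exact ih fun y hy => h y (by simp [hy])

theorem foldl_bracketStep_zipIdx {i : ℕ} (l : List ℕ) (k : ℕ) (s : List ℕ × List ℕ)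
    (h : ∀ x ∈ l, x ≠ i ∧ x ≠ i + 1) : (l.zipIdx k).foldl (bracketStep i) s = s :=
  foldl_bracketStep_of_forall_ne _ _ fun x hx => h x.1 (List.fst_mem_of_mem_zipIdx hx)

theorem unbracketed_append_cons_append_cons {i : ℕ} (A B C : List ℕ) (a b : ℕ)
    (hA : ∀ x ∈ A, x ≠ i ∧ x ≠ i + 1) (hB : ∀ x ∈ B, x ≠ i ∧ x ≠ i + 1)
    (hC : ∀ x ∈ C, x ≠ i ∧ x ≠ i + 1) :
    unbracketed i (A ++ a :: (B ++ b :: C)) =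
      bracketStep i (bracketStep i ([], []) (a, A.length)) (b, A.length + 1 + B.length) := by
  simp only [unbracketed, List.zipIdx_append, List.zipIdx_cons, List.foldl_append, List.foldl_cons,
    foldl_bracketStep_zipIdx _ _ _ hA, foldl_bracketStep_zipIdx _ _ _ hB,
    foldl_bracketStep_zipIdx _ _ _ hC, Nat.zero_add]

theorem maxPow_eq_zero {f : List ℕ → Option (List ℕ)} {w : List ℕ} (h : f w = none) :
    maxPow f w = 0 := by
  have key : ∀ k, opPow f (k + 1) w = none := by
    intro k
    induction k with
    | zero => simp [opPow, h]
    | succ k ih =>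
      rw [opPow, Function.iterate_succ_apply'] at *
      rw [Function.iterate_succ_apply', ih]; rfl
  have : {k | opPow f k w ≠ none} = {0} := by
    ext k
    cases k with
    | zero => simp [opPow]
    | succ k => simp [key]
  rw [maxPow, this, csSup_singleton]

theorem maxPow_eq_one {f : List ℕ → Option (List ℕ)} {w v : List ℕ} (h : f w = some v)
    (hv : f v = none) : maxPow f w = 1 := by
  have key : ∀ k, opPow f (k + 2) w = none := by
    intro k
    induction k with
    | zero => simp [opPow, h, hv]
    | succ k ih =>
      rw [opPow, Function.iterate_succ_apply'] at *
      rw [Function.iterate_succ_apply', ih]; rfl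
  have : {k | opPow f k w ≠ none} = {0, 1} := by
    ext k
    match k with
    | 0 => simp [opPow]
    | 1 => simp [opPow, h]
    | k + 2 => simp [key]
  rw [maxPow, this, csSup_pair]
  rfl

theorem set_second {α : Type*} (A B C : List α) (a b c : α) :
    (A ++ a :: (B ++ b :: C)).set (A.length + 1 + B.length) c = A ++ a :: (B ++ c :: C) := by
  rw [List.set_append_right _ _ (by omega), show A.length + 1 + B.length - A.length = B.length + 1
    by omega, List.set_cons_succ, List.set_append_right _ _ le_rfl]
  simp

/-- Nothing is bracketed, so r = s = 1: each operator applies once, making the two letters equal,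
and then gives 0. -/
theorem maxPow_of_lt {i : ℕ} (A B C : List ℕ)
    (hA : ∀ x ∈ A, x ≠ i ∧ x ≠ i + 1) (hB : ∀ x ∈ B, x ≠ i ∧ x ≠ i + 1)
    (hC : ∀ x ∈ C, x ≠ i ∧ x ≠ i + 1) :
    min (maxPow (epsOp i) (A ++ i :: (B ++ (i + 1) :: C)))
      (maxPow (phiOp i) (A ++ i :: (B ++ (i + 1) :: C))) = 1 := by
  have hu := fun a b => unbracketed_append_cons_append_cons A B C a b hA hB hC
  rw [maxPow_eq_one (f := epsOp i) (v := A ++ i :: (B ++ i :: C)),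
    maxPow_eq_one (f := phiOp i) (v := A ++ (i + 1) :: (B ++ (i + 1) :: C)), min_self]
  · simp [phiOp, hu, bracketStep]
  · simp [phiOp, hu, bracketStep]
  · simp [epsOp, hu, bracketStep, set_second]
  · simp [epsOp, hu, bracketStep]

/-- The two letters bracket each other, so the raising operator already gives 0. -/
theorem maxPow_of_gt {i : ℕ} (A B C : List ℕ)
    (hA : ∀ x ∈ A, x ≠ i ∧ x ≠ i + 1) (hB : ∀ x ∈ B, x ≠ i ∧ x ≠ i + 1)
    (hC : ∀ x ∈ C, x ≠ i ∧ x ≠ i + 1) :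
    min (maxPow (epsOp i) (A ++ (i + 1) :: (B ++ i :: C)))
      (maxPow (phiOp i) (A ++ (i + 1) :: (B ++ i :: C))) = 0 := by
  have hu := unbracketed_append_cons_append_cons A B C (i + 1) i hA hB hC
  rw [maxPow_eq_zero (f := epsOp i), zero_min]
  simp [epsOp, hu, bracketStep]

/-! ### The reading order on cells -/

/-- The cells of a diagram in the order of the row reading. -/
def readingCells (lam : YoungDiagram) : List (ℕ × ℕ) :=
  (List.range (lam.colLen 0)).reverse.flatMap fun i => (List.range (lam.rowLen i)).map (Prod.mk i)

theorem rowReading_eq_map {lam : YoungDiagram} (T : SemistandardYoungTableau lam) :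
    rowReading T = (readingCells lam).map fun c => T c.1 c.2 := by
  simp [rowReading, readingCells, List.map_flatMap, Function.comp_def]

theorem mem_readingCells {lam : YoungDiagram} {c : ℕ × ℕ} : c ∈ readingCells lam ↔ c ∈ lam := by
  obtain ⟨i, j⟩ := c
  simp only [readingCells, List.mem_flatMap, List.mem_reverse, List.mem_range, List.mem_map,
    Prod.mk.injEq]
  constructor
  · rintro ⟨_, _, _, h, rfl, rfl⟩
    exact YoungDiagram.mem_iff_lt_rowLen.2 h
  · intro h
    exact ⟨i, YoungDiagram.mem_iff_lt_colLen.1 (lam.up_left_mem le_rfl (Nat.zero_le j) h), j,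
      YoungDiagram.mem_iff_lt_rowLen.1 h, rfl, rfl⟩

theorem pairwise_readingCells (lam : YoungDiagram) :
    (readingCells lam).Pairwise fun c d => d.1 < c.1 ∨ c.1 = d.1 ∧ c.2 < d.2 := by
  rw [readingCells, List.pairwise_flatMap]
  constructor
  · intro i _
    rw [List.pairwise_map]
    exact List.pairwise_lt_range.imp fun h => Or.inr ⟨rfl, h⟩
  · rw [List.pairwise_reverse]
    refine List.pairwise_lt_range.imp fun h => ?_
    simp only [List.mem_map]
    rintro _ ⟨_, _, rfl⟩ _ ⟨_, _, rfl⟩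
    exact Or.inl h

/-- If `d` preceded `c` in the list, `R d c` would hold; hence `c` comes first. This decides which
of two letters is read first. -/
theorem exists_eq_append_of_pairwise {α : Type*} {R : α → α → Prop} {l : List α}
    (hl : l.Pairwise R) {c d : α} (hc : c ∈ l) (hd : d ∈ l) (hne : c ≠ d) (h : ¬ R d c) :
    ∃ A B C, l = A ++ c :: (B ++ d :: C) := by
  obtain ⟨A, D, rfl⟩ := List.append_of_mem hc
  have hdD : d ∈ D := by
    rcases List.mem_append.1 hd with hd | hd
    · exact absurd ((List.pairwise_append.1 hl).2.2 d hd c (by simp)) h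
    · exact (List.mem_cons.1 hd).resolve_left hne.symm
  obtain ⟨B, C, rfl⟩ := List.append_of_mem hdD
  exact ⟨A, B, C, rfl⟩

theorem nodup_readingCells (lam : YoungDiagram) : (readingCells lam).Nodup :=
  (pairwise_readingCells lam).imp fun h => by
    rintro rfl
    omega

/-! ### Standard tableaux -/

section Standard

variable {lam : YoungDiagram} {T : SemistandardYoungTableau lam} {N : ℕ}

theorem exists_cell_of_mem_tab (hT : T ∈ tab lam (rectWeight 1 N)) {p : ℕ} (hp : p < N) :
    ∃ c ∈ lam, T c.1 c.2 = p := by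
  have h := hT p
  rw [rectWeight, if_pos hp] at h
  obtain ⟨c, hc⟩ := Finset.card_pos.1 (h ▸ Nat.one_pos)
  rw [Finset.mem_filter] at hc
  exact ⟨c, hc.1, hc.2⟩

theorem lt_of_mem_tab (hT : T ∈ tab lam (rectWeight 1 N)) {c : ℕ × ℕ} (hc : c ∈ lam) :
    T c.1 c.2 < N := by
  by_contra hN
  have h := hT (T c.1 c.2)
  rw [rectWeight, if_neg hN, Finset.card_eq_zero] at h
  exact Finset.notMem_empty c (h ▸ Finset.mem_filter.2 ⟨hc, rfl⟩)

theorem injOn_of_mem_tab (hT : T ∈ tab lam (rectWeight 1 N)) {c d : ℕ × ℕ} (hc : c ∈ lam)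
    (hd : d ∈ lam) (h : T c.1 c.2 = T d.1 d.2) : c = d := by
  have h1 := hT (T c.1 c.2)
  rw [rectWeight, if_pos (lt_of_mem_tab hT hc)] at h1
  exact Finset.card_le_one.1 h1.le c (Finset.mem_filter.2 ⟨hc, rfl⟩) d
    (Finset.mem_filter.2 ⟨hd, h.symm⟩)

/-- `p` is a descent of `T` if the letter `p + 1` lies in a lower row than the letter `p`. -/
def IsDescent (T : SemistandardYoungTableau lam) (p : ℕ) : Prop :=
  ∀ c ∈ lam, ∀ d ∈ lam, T c.1 c.2 = p → T d.1 d.2 = p + 1 → c.1 < d.1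

theorem forall_ne_of_readingCells_eq (hT : T ∈ tab lam (rectWeight 1 N)) {c d : ℕ × ℕ}
    {A B C : List (ℕ × ℕ)} (h : readingCells lam = A ++ c :: (B ++ d :: C)) :
    (∀ l ∈ [A, B, C], ∀ x ∈ l.map (fun c => T c.1 c.2), x ≠ T c.1 c.2 ∧ x ≠ T d.1 d.2) := by
  have hn := nodup_readingCells lam
  have hm : ∀ e, e ∈ A ++ c :: (B ++ d :: C) → e ∈ lam := fun e he => by
    rwa [← h, mem_readingCells] at he
  rw [h] at hn
  intro l hl x hx
  obtain ⟨e, he, rfl⟩ := List.mem_map.1 hx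
  have heL : e ∈ A ++ c :: (B ++ d :: C) := by
    simp only [List.mem_cons, List.not_mem_nil, or_false] at hl
    rcases hl with rfl | rfl | rfl <;> simp [he]
  have hec : e ≠ c ∧ e ≠ d := by
    simp only [List.mem_cons, List.not_mem_nil, or_false] at hl
    constructor <;> rintro rfl <;> rcases hl with rfl | rfl | rfl <;> grind [List.nodup_append]
  exact ⟨fun hh => hec.1 (injOn_of_mem_tab hT (hm e heL) (hm c (by simp)) hh),
    fun hh => hec.2 (injOn_of_mem_tab hT (hm e heL) (hm d (by simp)) hh)⟩

open Classical in
theorem exponent_eq_ite (hT : T ∈ tab lam (rectWeight 1 N)) {p : ℕ} (hp : p + 1 < N) :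
    exponent p T = if IsDescent T p then 0 else 1 := by
  obtain ⟨c, hc, hcp⟩ := exists_cell_of_mem_tab hT (Nat.lt_of_succ_lt hp)
  obtain ⟨d, hd, hdp⟩ := exists_cell_of_mem_tab hT hp
  have hne : c ≠ d := by rintro rfl; omega
  have hdes : IsDescent T p ↔ c.1 < d.1 := by
    refine ⟨fun h => h c hc d hd hcp hdp, fun h c' hc' d' hd' h1 h2 => ?_⟩
    rwa [injOn_of_mem_tab hT hc' hc (h1.trans hcp.symm),
      injOn_of_mem_tab hT hd' hd (h2.trans hdp.symm)]
  rw [exponent, rowReading_eq_map]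
  split_ifs with h
  · rw [hdes] at h
    obtain ⟨A, B, C, hL⟩ := exists_eq_append_of_pairwise (pairwise_readingCells lam)
      (mem_readingCells.2 hd) (mem_readingCells.2 hc) hne.symm (by omega)
    have := forall_ne_of_readingCells_eq hT hL
    simp only [List.mem_cons, List.not_mem_nil, or_false, forall_eq_or_imp, forall_eq, hcp, hdp]
      at this
    simp only [hL, List.map_append, List.map_cons, hcp, hdp]
    exact maxPow_of_gt _ _ _ (fun x hx => (this.1 x hx).symm) (fun x hx => (this.2.1 x hx).symm)
      fun x hx => (this.2.2 x hx).symm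
  · rw [hdes] at h
    -- Reading `d` before `c` would require `d` in a lower row, which is excluded, or to the left in
    -- the same row, against weak increase along rows.
    have hR : ¬ (c.1 < d.1 ∨ d.1 = c.1 ∧ d.2 < c.2) := by
      rintro (h' | ⟨h1, h2⟩)
      · exact h h'
      · have := T.row_weak h2 (show (d.1, c.2) ∈ lam from h1 ▸ hc)
        rw [hdp, h1, hcp] at this
        omega
    obtain ⟨A, B, C, hL⟩ := exists_eq_append_of_pairwise (pairwise_readingCells lam)
      (mem_readingCells.2 hc) (mem_readingCells.2 hd) hne hR
    have := forall_ne_of_readingCells_eq hT hL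
    simp only [List.mem_cons, List.not_mem_nil, or_false, forall_eq_or_imp, forall_eq, hcp, hdp]
      at this
    simp only [hL, List.map_append, List.map_cons, hcp, hdp]
    exact maxPow_of_lt _ _ _ this.1 this.2.1 this.2.2

end Standard
end CrystalKostka
end

/-! ### Standard tableaux with prescribed descents and semistandard tableaux of the conjugate shape.
-/

noncomputable section
namespace CrystalKostka

/-! ### Ranks -/

section Rank

variable {α β : Type*} [LinearOrder β]

/-- The number of elements of `s` whose key is smaller than that of `c`. -/
def rankIn (s : Finset α) (key : α → β) (c : α) : ℕ :=
  (s.filter fun d => key d < key c).card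

theorem rankIn_lt_rankIn_iff {s : Finset α} {key : α → β} {c d : α} (hc : c ∈ s) :
    rankIn s key c < rankIn s key d ↔ key c < key d := by
  constructor
  · intro h
    by_contra hcd
    refine absurd h (not_lt.2 (Finset.card_le_card fun e he => ?_))
    rw [Finset.mem_filter] at he ⊢
    exact ⟨he.1, he.2.trans_le (not_lt.1 hcd)⟩
  · intro h
    refine Finset.card_lt_card ⟨fun e he => ?_, fun hsub => ?_⟩
    · rw [Finset.mem_filter] at he ⊢
      exact ⟨he.1, he.2.trans h⟩
    · exact lt_irrefl _ (Finset.mem_filter.1 (hsub (Finset.mem_filter.2 ⟨hc, h⟩))).2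

theorem rankIn_lt_card {s : Finset α} {key : α → β} {c : α} (hc : c ∈ s) :
    rankIn s key c < s.card :=
  Finset.card_lt_card ⟨Finset.filter_subset _ _, fun h =>
    lt_irrefl _ (Finset.mem_filter.1 (h hc)).2⟩

theorem injOn_rankIn {s : Finset α} {key : α → β} (hkey : Set.InjOn key s) :
    Set.InjOn (rankIn s key) s := by
  intro c hc d hd h
  refine hkey hc hd (le_antisymm (not_lt.1 fun h' => ?_) (not_lt.1 fun h' => ?_))
  · exact absurd h ((rankIn_lt_rankIn_iff hd).2 h').ne'
  · exact absurd h ((rankIn_lt_rankIn_iff hc).2 h').ne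

theorem card_filter_rankIn_eq {s : Finset α} {key : α → β} (hkey : Set.InjOn key s) (j : ℕ) :
    (s.filter fun c => rankIn s key c = j).card = if j < s.card then 1 else 0 := by
  classical
  split_ifs with hj
  · have himg : s.image (rankIn s key) = Finset.range s.card := by
      refine Finset.eq_of_subset_of_card_le (fun x hx => ?_) ?_
      · obtain ⟨c, hc, rfl⟩ := Finset.mem_image.1 hx
        exact Finset.mem_range.2 (rankIn_lt_card hc)
      · rw [Finset.card_range, Finset.card_image_of_injOn (injOn_rankIn hkey)]
    obtain ⟨c, hc, rfl⟩ := Finset.mem_image.1 (himg ▸ Finset.mem_range.2 hj)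
    rw [Finset.card_eq_one]
    refine ⟨c, Finset.ext fun d => ?_⟩
    rw [Finset.mem_filter, Finset.mem_singleton]
    exact ⟨fun h => injOn_rankIn hkey h.1 hc h.2, by rintro rfl; exact ⟨hc, rfl⟩⟩
  · rw [Finset.card_eq_zero, Finset.filter_eq_empty_iff]
    intro c hc h
    exact hj (h ▸ rankIn_lt_card hc)

end Rank

/-! ### Standardization -/

theorem card_filter_lt_eq_sum {α : Type*} (s : Finset α) (f : α → ℕ) (u : ℕ) :
    (s.filter fun c => f c < u).card = ∑ j ∈ Finset.range u, (s.filter fun c => f c = j).card := by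
  rw [Finset.card_eq_sum_card_fiberwise (f := f) (t := Finset.range u)]
  · refine Finset.sum_congr rfl fun j hj => ?_
    rw [Finset.filter_filter]
    congr 1
    refine Finset.filter_congr fun c _ => ?_
    rw [Finset.mem_range] at hj
    constructor
    · exact fun h => h.2
    · rintro rfl
      exact ⟨hj, rfl⟩
  · intro c hc
    simpa using (Finset.mem_filter.1 hc).2

theorem card_filter_transpose (lam : YoungDiagram) (P : ℕ → ℕ → Prop) [∀ i j, Decidable (P i j)] :
    (lam.transpose.cells.filter fun c => P c.1 c.2).card =
      (lam.cells.filter fun c => P c.2 c.1).card := by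
  refine Finset.card_bij (fun c _ => c.swap) (fun c hc => ?_)
    (fun c _ d _ h => Prod.swap_injective h) fun c hc => ⟨c.swap, ?_, Prod.swap_swap c⟩
  · rw [Finset.mem_filter, YoungDiagram.mem_cells] at hc ⊢
    exact ⟨YoungDiagram.mem_transpose.1 hc.1, hc.2⟩
  · rw [Finset.mem_filter, YoungDiagram.mem_cells] at hc ⊢
    exact ⟨YoungDiagram.mem_transpose.2 (by simpa using hc.1), hc.2⟩

section Standardization

variable {lam : YoungDiagram} {N : ℕ} {b : ℕ → ℕ} {T : SemistandardYoungTableau lam}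

/-- Each letter `0, 1, …` occurs once, so a standard tableau is determined by the order it puts on
its cells. -/
theorem eq_card_filter_lt_of_mem_tab (hT : T ∈ tab lam (rectWeight 1 N)) {c : ℕ × ℕ}
    (hc : c ∈ lam) :
    T c.1 c.2 = (lam.cells.filter fun d => T d.1 d.2 < T c.1 c.2).card := by
  have hN := lt_of_mem_tab hT hc
  rw [card_filter_lt_eq_sum _ (fun d : ℕ × ℕ => T d.1 d.2),
    Finset.sum_congr rfl (g := fun _ => 1) fun j hj => ?_]
  · simp
  · rw [hT j, rectWeight, if_pos ((Finset.mem_range.1 hj).trans hN)]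

/-- The letters `p` and `p + 1` of every block of `b` form a descent of `T`. -/
def DescentsInBlocks (N : ℕ) (b : ℕ → ℕ) (T : SemistandardYoungTableau lam) : Prop :=
  ∀ p, p + 1 < N → b p = b (p + 1) → IsDescent T p

/-- By monotonicity of `b` all letters between the two lie in the same block, so a chain of descents
joins them. -/
theorem fst_lt_fst_of_block_eq (hb : Monotone b) (hT : T ∈ tab lam (rectWeight 1 N))
    (h : DescentsInBlocks N b T) {c d : ℕ × ℕ} (hc : c ∈ lam) (hd : d ∈ lam)
    (hlt : T c.1 c.2 < T d.1 d.2) (hbe : b (T c.1 c.2) = b (T d.1 d.2)) : c.1 < d.1 := by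
  obtain ⟨q, hq⟩ : ∃ q, T d.1 d.2 = q + 1 := ⟨_, (Nat.succ_pred (by omega)).symm⟩
  induction q generalizing d with
  | zero =>
    have hq' : T c.1 c.2 = 0 := by omega
    exact h 0 (hq ▸ lt_of_mem_tab hT hd) (by rw [← hq', hbe, hq, hq']) c hc d hd hq' hq
  | succ q ih =>
    have hN : q + 1 + 1 < N := hq ▸ lt_of_mem_tab hT hd
    have hb1 : b (T c.1 c.2) ≤ b (q + 1) := hb (by omega)
    have hb2 : b (q + 1) ≤ b (q + 1 + 1) := hb (by omega)
    rw [hq] at hbe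
    obtain ⟨e, he, heq⟩ := exists_cell_of_mem_tab hT (Nat.lt_of_succ_lt hN)
    have hed : e.1 < d.1 := h (q + 1) hN (by omega) e he d hd heq hq
    rcases (show T c.1 c.2 = q + 1 ∨ T c.1 c.2 < q + 1 by omega) with h1 | h1
    · rwa [injOn_of_mem_tab hT hc he (h1.trans heq.symm)]
    · exact (ih he (by omega) (by rw [heq]; omega) heq).trans hed

/-- The order of the cells can be recovered from blocks and rows alone; this makes `destandardize`
injective. -/
theorem lt_iff_block_lt_or (hb : Monotone b) (hT : T ∈ tab lam (rectWeight 1 N))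
    (h : DescentsInBlocks N b T) {c d : ℕ × ℕ} (hc : c ∈ lam) (hd : d ∈ lam) :
    T c.1 c.2 < T d.1 d.2 ↔
      b (T c.1 c.2) < b (T d.1 d.2) ∨ b (T c.1 c.2) = b (T d.1 d.2) ∧ c.1 < d.1 := by
  constructor
  · intro hlt
    rcases (hb hlt.le).lt_or_eq with h1 | h1
    · exact Or.inl h1
    · exact Or.inr ⟨h1, fst_lt_fst_of_block_eq hb hT h hc hd hlt h1⟩
  · intro hkey
    by_contra hle
    rcases (not_lt.1 hle).lt_or_eq with h1 | h1
    · rcases hkey with h2 | ⟨h2, h3⟩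
      · exact absurd (hb h1.le) (not_le.2 h2)
      · exact lt_asymm h3 (fst_lt_fst_of_block_eq hb hT h hd hc h1 h2.symm)
    · obtain rfl := injOn_of_mem_tab hT hd hc h1
      omega

/-- Replacing every letter of a standard tableau by its block and transposing. -/
def destandardize (hb : Monotone b) (hT : T ∈ tab lam (rectWeight 1 N))
    (h : DescentsInBlocks N b T) : SemistandardYoungTableau lam.transpose where
  entry j r := if (r, j) ∈ lam then b (T r j) else 0
  row_weak' {j r₁ r₂} hr hmem := by
    replace hmem : (r₂, j) ∈ lam := YoungDiagram.mem_transpose.1 hmem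
    rw [if_pos hmem, if_pos (lam.up_left_mem hr.le le_rfl hmem)]
    exact hb (T.col_strict hr hmem).le
  col_strict' {j₁ j₂ r} hj hmem := by
    replace hmem : (r, j₂) ∈ lam := YoungDiagram.mem_transpose.1 hmem
    have hmem₁ := lam.up_left_mem le_rfl hj.le hmem
    rw [if_pos hmem, if_pos hmem₁]
    have hlt : T r j₁ < T r j₂ := by
      refine lt_of_le_of_ne (T.row_weak hj hmem) fun he => hj.ne ?_
      exact congrArg Prod.snd (injOn_of_mem_tab hT hmem₁ hmem he)
    -- Two letters of one block lie in different rows, whereas these cells share row `r`.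
    refine lt_of_le_of_ne (hb hlt.le) fun he => ?_
    exact lt_irrefl r (fst_lt_fst_of_block_eq hb hT h hmem₁ hmem hlt he)
  zeros' {j r} hmem := if_neg fun h' => hmem (YoungDiagram.mem_transpose.2 h')

theorem destandardize_apply (hb : Monotone b) (hT : T ∈ tab lam (rectWeight 1 N))
    (h : DescentsInBlocks N b T) {c : ℕ × ℕ} (hc : c ∈ lam) :
    destandardize hb hT h c.2 c.1 = b (T c.1 c.2) :=
  if_pos hc

/-- The number of letters below `N` in each block of `b`. -/
def blockWeight (N : ℕ) (b : ℕ → ℕ) : ℕ → ℕ :=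
  fun j => ((Finset.range N).filter fun p => b p = j).card

theorem destandardize_mem_tab (hb : Monotone b) (hT : T ∈ tab lam (rectWeight 1 N))
    (h : DescentsInBlocks N b T) :
    destandardize hb hT h ∈ tab lam.transpose (blockWeight N b) := by
  intro j
  rw [card_filter_transpose lam fun r s => destandardize hb hT h r s = j]
  refine Finset.card_bij (fun c _ => T c.1 c.2) (fun c hc => ?_) (fun c hc d hd hcd => ?_)
    fun p hp => ?_
  · obtain ⟨hc, hj⟩ := Finset.mem_filter.1 hc
    rw [destandardize_apply hb hT h hc] at hj
    exact Finset.mem_filter.2 ⟨Finset.mem_range.2 (lt_of_mem_tab hT hc), hj⟩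
  · exact injOn_of_mem_tab hT (Finset.mem_filter.1 hc).1 (Finset.mem_filter.1 hd).1 hcd
  · rw [Finset.mem_filter, Finset.mem_range] at hp
    obtain ⟨c, hc, rfl⟩ := exists_cell_of_mem_tab hT hp.1
    exact ⟨c, Finset.mem_filter.2 ⟨hc, (destandardize_apply hb hT h hc).trans hp.2⟩, rfl⟩

theorem destandardize_injective (hb : Monotone b) {T' : SemistandardYoungTableau lam}
    (hT : T ∈ tab lam (rectWeight 1 N)) (hT' : T' ∈ tab lam (rectWeight 1 N))
    (h : DescentsInBlocks N b T) (h' : DescentsInBlocks N b T')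
    (heq : destandardize hb hT h = destandardize hb hT' h') : T = T' := by
  have hbT : ∀ c ∈ lam, b (T c.1 c.2) = b (T' c.1 c.2) := fun c hc => by
    rw [← destandardize_apply hb hT h hc, heq, destandardize_apply hb hT' h' hc]
  ext r j
  by_cases hc : (r, j) ∈ lam
  · rw [eq_card_filter_lt_of_mem_tab (c := (r, j)) hT hc,
      eq_card_filter_lt_of_mem_tab (c := (r, j)) hT' hc]
    congr 1
    refine Finset.filter_congr fun d hd => ?_
    rw [lt_iff_block_lt_or hb hT h hd hc, lt_iff_block_lt_or hb hT' h' hd hc, hbT d hd, hbT _ hc]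
  · rw [T.zeros hc, T'.zeros hc]

/-- The order in which the standardization numbers the cells of the transposed tableau. -/
def cellKey (U : SemistandardYoungTableau lam.transpose) (c : ℕ × ℕ) : ℕ ×ₗ ℕ :=
  toLex (U c.2 c.1, c.1)

theorem cellKey_lt_iff {U : SemistandardYoungTableau lam.transpose} {c d : ℕ × ℕ} :
    cellKey U c < cellKey U d ↔ U c.2 c.1 < U d.2 d.1 ∨ U c.2 c.1 = U d.2 d.1 ∧ c.1 < d.1 :=
  Prod.Lex.toLex_lt_toLex

/-- Cells in one row of `lam` form part of a column of the transpose, where `U` is strict. -/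
theorem injOn_cellKey (U : SemistandardYoungTableau lam.transpose) :
    Set.InjOn (cellKey U) lam.cells := by
  rintro ⟨r, j⟩ hc ⟨r', j'⟩ hd h
  have h1 : U j r = U j' r' := congrArg (fun x => (ofLex x).1) h
  obtain rfl : r = r' := congrArg (fun x => (ofLex x).2) h
  rcases lt_trichotomy j j' with hj | rfl | hj
  · exact absurd h1 (U.col_strict hj (YoungDiagram.mem_transpose.2 hd)).ne
  · rfl
  · exact absurd h1 (U.col_strict hj (YoungDiagram.mem_transpose.2 hc)).ne'

/-- The standardization of a tableau of the transposed shape. -/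
def standardize (U : SemistandardYoungTableau lam.transpose) : SemistandardYoungTableau lam where
  entry r j := if (r, j) ∈ lam then rankIn lam.cells (cellKey U) (r, j) else 0
  row_weak' {r j₁ j₂} hj hmem := by
    have hmem₁ := lam.up_left_mem le_rfl hj.le hmem
    rw [if_pos hmem, if_pos hmem₁]
    refine ((rankIn_lt_rankIn_iff hmem₁).2 (cellKey_lt_iff.2 (Or.inl ?_))).le
    exact U.col_strict hj (YoungDiagram.mem_transpose.2 hmem)
  col_strict' {r₁ r₂ j} hr hmem := by
    have hmem₁ := lam.up_left_mem hr.le le_rfl hmem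
    rw [if_pos hmem, if_pos hmem₁]
    refine (rankIn_lt_rankIn_iff hmem₁).2 (cellKey_lt_iff.2 ?_)
    exact (U.row_weak hr (YoungDiagram.mem_transpose.2 hmem)).lt_or_eq.imp id fun h => ⟨h, hr⟩
  zeros' hmem := if_neg hmem

variable {U : SemistandardYoungTableau lam.transpose}

theorem standardize_apply {c : ℕ × ℕ} (hc : c ∈ lam) :
    standardize U c.1 c.2 = rankIn lam.cells (cellKey U) c :=
  if_pos hc

theorem standardize_mem_tab (U : SemistandardYoungTableau lam.transpose) :
    standardize U ∈ tab lam (rectWeight 1 lam.card) := by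
  intro j
  rw [rectWeight, ← card_filter_rankIn_eq (injOn_cellKey U)]
  congr 1
  exact Finset.filter_congr fun c hc => by rw [standardize_apply hc]

/-- For every `u`, as many cells have entry below `u` as there are letters in blocks below `u`,
since the weights agree. Both families are initial segments, in the key order and in `ℕ`, so the
cell of rank `p` carries the block of `p`. -/
theorem block_standardize (hb : Monotone b) (hU : U ∈ tab lam.transpose (blockWeight lam.card b))
    {c : ℕ × ℕ} (hc : c ∈ lam) : b (standardize U c.1 c.2) = U c.2 c.1 := by
  have hcount : ∀ u, (lam.cells.filter fun d => U d.2 d.1 < u).card =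
      ((Finset.range lam.card).filter fun p => b p < u).card := fun u => by
    rw [← card_filter_transpose lam fun r s => U r s < u,
      card_filter_lt_eq_sum _ fun c : ℕ × ℕ => U c.1 c.2, card_filter_lt_eq_sum]
    exact Finset.sum_congr rfl fun j _ => hU j
  have hN : standardize U c.1 c.2 < lam.card := lt_of_mem_tab (standardize_mem_tab U) hc
  rw [standardize_apply hc] at hN ⊢
  set p := rankIn lam.cells (cellKey U) c with hp
  refine le_antisymm (not_lt.1 fun hlt => ?_) (not_lt.1 fun hlt => ?_)
  · have h1 := hcount (U c.2 c.1 + 1)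
    have h2 : ((Finset.range lam.card).filter fun q => b q < U c.2 c.1 + 1).card ≤ p := by
      rw [← Finset.card_range p]
      refine Finset.card_le_card fun q hq => Finset.mem_range.2 (not_le.1 fun hpq => ?_)
      have := hb hpq
      have := (Finset.mem_filter.1 hq).2
      omega
    -- The strictness comes from `c` itself, which is not counted in its own rank.
    have h3 : p < (lam.cells.filter fun d => U d.2 d.1 < U c.2 c.1 + 1).card := by
      refine Finset.card_lt_card ⟨fun d hd => ?_, fun hsub => ?_⟩
      · rw [Finset.mem_filter, cellKey_lt_iff] at hd
        exact Finset.mem_filter.2 ⟨hd.1, by omega⟩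
      · exact lt_irrefl _ (Finset.mem_filter.1
          (hsub (Finset.mem_filter.2 ⟨hc, Nat.lt_succ_self _⟩))).2
    omega
  · have h1 := hcount (U c.2 c.1)
    have h2 : p + 1 ≤ ((Finset.range lam.card).filter fun q => b q < U c.2 c.1).card := by
      rw [← Finset.card_range (p + 1)]
      refine Finset.card_le_card fun q hq => ?_
      have hq := Finset.mem_range.1 hq
      refine Finset.mem_filter.2 ⟨Finset.mem_range.2 (by omega), ?_⟩
      exact (hb (show q ≤ p by omega)).trans_lt hlt
    have h3 : (lam.cells.filter fun d => U d.2 d.1 < U c.2 c.1).card ≤ p := by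
      refine Finset.card_le_card fun d hd => ?_
      rw [Finset.mem_filter] at hd
      exact Finset.mem_filter.2 ⟨hd.1, cellKey_lt_iff.2 (Or.inl hd.2)⟩
    omega

theorem descentsInBlocks_standardize (hb : Monotone b)
    (hU : U ∈ tab lam.transpose (blockWeight lam.card b)) :
    DescentsInBlocks lam.card b (standardize U) := by
  intro p _ hbp c hc d hd hcp hdp
  have hlt : standardize U c.1 c.2 < standardize U d.1 d.2 := by omega
  rw [← hcp, hcp, ← hdp, ← hcp, block_standardize hb hU hc, block_standardize hb hU hd] at hbp
  rw [standardize_apply hc, standardize_apply hd, rankIn_lt_rankIn_iff hc, cellKey_lt_iff] at hlt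
  omega

open Classical in
/-- Standard tableaux with prescribed descents correspond to semistandard tableaux of the
transposed shape. -/
theorem card_descentsInBlocks (lam : YoungDiagram) (hb : Monotone b) :
    ((tab_finite lam (rectWeight 1 lam.card)).toFinset.filter
      fun T => DescentsInBlocks lam.card b T).card =
      kostka lam.transpose (blockWeight lam.card b) := by
  refine Finset.card_bij
    (fun T hT => destandardize hb ((Set.Finite.mem_toFinset _).1 (Finset.mem_filter.1 hT).1)
      (Finset.mem_filter.1 hT).2) (fun T hT => ?_) (fun T hT T' hT' h => ?_) fun U hU => ?_
  · exact (Set.Finite.mem_toFinset _).2 (destandardize_mem_tab _ _ _)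
  · exact destandardize_injective hb _ _ _ _ h
  · rw [Set.Finite.mem_toFinset] at hU
    refine ⟨standardize U, Finset.mem_filter.2 ⟨(Set.Finite.mem_toFinset _).2
      (standardize_mem_tab U), descentsInBlocks_standardize hb hU⟩, ?_⟩
    ext j r
    by_cases hc : (r, j) ∈ lam
    · rw [destandardize_apply (c := (r, j)) hb _ _ hc, block_standardize hb hU hc]
    · have : (j, r) ∉ lam.transpose := fun h => hc (YoungDiagram.mem_transpose.1 h)
      rw [SemistandardYoungTableau.zeros _ this, U.zeros this]

end Standardization
end CrystalKostka
end

/-! ### Symmetry of Kostka numbers in the weight. -/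

noncomputable section
namespace CrystalKostka

/-! ### The Bender–Knuth involution -/

section BenderKnuth

variable {lam : YoungDiagram}

/-- The number of cells of the row `r` of `T` with an entry less than `k`. -/
def rowCount (T : SemistandardYoungTableau lam) (k r : ℕ) : ℕ :=
  ((Finset.range (lam.rowLen r)).filter fun j => T r j < k).card

theorem eq_of_forall_lt_iff_nat {a b : ℕ} (h : ∀ j, j < a ↔ j < b) : a = b :=
  le_antisymm (not_lt.1 fun h' => lt_irrefl _ ((h b).1 h'))
    (not_lt.1 fun h' => lt_irrefl _ ((h a).2 h'))

/-- Entries below `k` form an initial segment of the row. The numbers `rowCount T k r` are thus the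
Gelfand–Tsetlin coordinates of `T`, in which the involution is a reflection of one level. -/
theorem lt_rowCount_iff {T : SemistandardYoungTableau lam} {k r j : ℕ} :
    j < rowCount T k r ↔ (r, j) ∈ lam ∧ T r j < k := by
  have hmem : ∀ j, j ∈ (Finset.range (lam.rowLen r)).filter (fun j => T r j < k) ↔
      (r, j) ∈ lam ∧ T r j < k := fun j => by
    rw [Finset.mem_filter, Finset.mem_range, YoungDiagram.mem_iff_lt_rowLen]
  have hdown : ∀ j j', j' ≤ j → (r, j) ∈ lam ∧ T r j < k → (r, j') ∈ lam ∧ T r j' < k :=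
    fun j j' hj h => ⟨lam.up_left_mem le_rfl hj h.1, (T.row_weak_of_le hj h.1).trans_lt h.2⟩
  constructor
  · intro h
    by_contra hj
    refine absurd h (not_lt.2 ?_)
    rw [← Finset.card_range j]
    refine Finset.card_le_card fun j' hj' => Finset.mem_range.2 (not_le.1 fun hle => ?_)
    exact hj (hdown j' j hle ((hmem j').1 hj'))
  · intro h
    rw [← Nat.succ_le_iff, ← Finset.card_range j.succ]
    refine Finset.card_le_card fun j' hj' => (hmem j').2 (hdown j j' ?_ h)
    exact Nat.lt_succ_iff.1 (Finset.mem_range.1 hj')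

theorem rowCount_mono (T : SemistandardYoungTableau lam) {k l : ℕ} (h : k ≤ l) (r : ℕ) :
    rowCount T k r ≤ rowCount T l r :=
  not_lt.1 fun hlt => by
    obtain ⟨h1, h2⟩ := lt_rowCount_iff.1 hlt
    exact lt_irrefl _ (lt_rowCount_iff.2 ⟨h1, h2.trans_le h⟩)

/-- Strictness of columns gives the interlacing inequality between consecutive levels. -/
theorem rowCount_succ_le (T : SemistandardYoungTableau lam) (k r : ℕ) :
    rowCount T (k + 1) (r + 1) ≤ rowCount T k r :=
  not_lt.1 fun hlt => by
    obtain ⟨h1, h2⟩ := lt_rowCount_iff.1 hlt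
    have h3 := T.col_strict (Nat.lt_add_one r) h1
    exact lt_irrefl _ (lt_rowCount_iff.2 ⟨lam.up_left_mem (Nat.le_succ r) le_rfl h1, by omega⟩)

theorem rowCount_colLen (T : SemistandardYoungTableau lam) (k : ℕ) :
    rowCount T k (lam.colLen 0) = 0 := by
  refine Nat.eq_zero_of_not_pos fun h => ?_
  exact lt_irrefl _ (YoungDiagram.mem_iff_lt_colLen.1 (lt_rowCount_iff.1 h).1)

theorem eq_of_rowCount_eq {T T' : SemistandardYoungTableau lam}
    (h : ∀ k r, rowCount T k r = rowCount T' k r) : T = T' := by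
  ext r j
  by_cases hc : (r, j) ∈ lam
  · have key : ∀ k, T r j < k ↔ T' r j < k := fun k => by
      have h1 := lt_rowCount_iff (T := T) (k := k) (r := r) (j := j)
      have h2 := lt_rowCount_iff (T := T') (k := k) (r := r) (j := j)
      rw [h] at h1
      simpa [hc] using h1.symm.trans h2
    have h1 := (key (T r j + 1)).1 (Nat.lt_succ_self _)
    have h2 := (key (T' r j + 1)).2 (Nat.lt_succ_self _)
    omega
  · rw [T.zeros hc, T'.zeros hc]

theorem card_filter_lt_eq_sum_rowCount (T : SemistandardYoungTableau lam) (k : ℕ) :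
    (lam.cells.filter fun c => T c.1 c.2 < k).card =
      ∑ r ∈ Finset.range (lam.colLen 0), rowCount T k r := by
  rw [Finset.card_eq_sum_card_fiberwise (f := Prod.fst) (t := Finset.range (lam.colLen 0))]
  · refine Finset.sum_congr rfl fun r _ => ?_
    rw [Finset.filter_filter]
    refine (Finset.card_bij (fun j _ => (r, j)) (fun j hj => ?_)
      (fun j _ j' _ h => congrArg Prod.snd h) fun c hc => ?_).symm
    · rw [Finset.mem_filter, Finset.mem_range, ← YoungDiagram.mem_iff_lt_rowLen] at hj
      exact Finset.mem_filter.2 ⟨hj.1, hj.2, rfl⟩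
    · obtain ⟨h1, h2, rfl⟩ := Finset.mem_filter.1 hc
      exact ⟨c.2, Finset.mem_filter.2
        ⟨Finset.mem_range.2 (YoungDiagram.mem_iff_lt_rowLen.1 h1), h2⟩, rfl⟩
  · intro c hc
    have hc := (Finset.mem_filter.1 hc).1
    rw [Finset.mem_coe, Finset.mem_range, ← YoungDiagram.mem_iff_lt_colLen]
    exact lam.up_left_mem le_rfl (Nat.zero_le _) hc

theorem card_filter_lt_succ (T : SemistandardYoungTableau lam) (k : ℕ) :
    (lam.cells.filter fun c => T c.1 c.2 < k + 1).card =
      (lam.cells.filter fun c => T c.1 c.2 < k).card +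
        (lam.cells.filter fun c => T c.1 c.2 = k).card := by
  rw [card_filter_lt_eq_sum _ (fun c : ℕ × ℕ => T c.1 c.2),
    card_filter_lt_eq_sum _ (fun c : ℕ × ℕ => T c.1 c.2), Finset.sum_range_succ]

/-- The least possible number of letters at most `i` in the row `r`, given the other letters than
`i` and `i + 1`. -/
def toggleMin (T : SemistandardYoungTableau lam) (i r : ℕ) : ℕ :=
  max (rowCount T i r) (rowCount T (i + 2) (r + 1))

/-- The largest possible number of letters at most `i` in the row `r`, given the other letters than
`i` and `i + 1`. -/
def toggleMax (T : SemistandardYoungTableau lam) (i : ℕ) : ℕ → ℕ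
  | 0 => rowCount T (i + 2) 0
  | r + 1 => min (rowCount T (i + 2) (r + 1)) (rowCount T i r)

/-- The toggled number of letters at most `i` in the row `r`. -/
def toggle (T : SemistandardYoungTableau lam) (i r : ℕ) : ℕ :=
  toggleMin T i r + toggleMax T i r - rowCount T (i + 1) r

variable (T : SemistandardYoungTableau lam) (i r : ℕ)

theorem toggleMin_le : toggleMin T i r ≤ rowCount T (i + 1) r :=
  max_le (rowCount_mono T (Nat.le_succ i) r) (rowCount_succ_le T (i + 1) r)

theorem le_toggleMax : rowCount T (i + 1) r ≤ toggleMax T i r := by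
  cases r with
  | zero => exact rowCount_mono T (Nat.le_succ _) 0
  | succ r => exact le_min (rowCount_mono T (Nat.le_succ _) _) (rowCount_succ_le T i r)

theorem toggleMax_le : toggleMax T i r ≤ rowCount T (i + 2) r := by
  cases r with
  | zero => exact le_rfl
  | succ r => exact min_le_left _ _

theorem toggleMin_le_toggle : toggleMin T i r ≤ toggle T i r := by
  have := le_toggleMax T i r
  rw [toggle]
  omega

theorem toggle_le_toggleMax : toggle T i r ≤ toggleMax T i r := by
  have := toggleMin_le T i r
  rw [toggle]
  omega

/-- The reflection in additive form; the natural subtraction in `toggle` does not truncate. -/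
theorem toggle_add : toggle T i r + rowCount T (i + 1) r = toggleMin T i r + toggleMax T i r := by
  have := le_toggleMax T i r
  rw [toggle]
  omega

/-- The entries of the tableau obtained from `T` by the Bender–Knuth involution. -/
def benderKnuthEntry (r j : ℕ) : ℕ :=
  if (r, j) ∈ lam ∧ i ≤ T r j ∧ T r j ≤ i + 1 then if j < toggle T i r then i else i + 1
  else T r j

theorem benderKnuthEntry_cases (r j : ℕ) :
    (i ≤ T r j ∧ T r j ≤ i + 1 ∧ i ≤ benderKnuthEntry T i r j ∧ benderKnuthEntry T i r j ≤ i + 1) ∨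
      benderKnuthEntry T i r j = T r j := by
  rw [benderKnuthEntry]
  split_ifs <;> omega

/-- The Bender–Knuth involution. -/
def benderKnuth : SemistandardYoungTableau lam where
  entry := benderKnuthEntry T i
  row_weak' {r j₁ j₂} hj hmem := by
    have hmem₁ := lam.up_left_mem le_rfl hj.le hmem
    have := T.row_weak hj hmem
    simp only [benderKnuthEntry, hmem, hmem₁, true_and]
    split_ifs <;> omega
  col_strict' {r₁ r₂ j} hr hmem := by
    have hmem₁ := lam.up_left_mem hr.le le_rfl hmem
    have hlt := T.col_strict hr hmem
    -- Changes stay within `{i, i + 1}`, so strictness is at risk only for an `i` above an `i + 1`,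
    -- necessarily in adjacent rows. The bounds `toggleMin` and `toggleMax` then keep both entries
    -- fixed.
    by_cases hboth : T r₁ j = i ∧ T r₂ j = i + 1
    · obtain ⟨h1, h2⟩ := hboth
      obtain rfl : r₂ = r₁ + 1 := by
        by_contra hne
        have := T.col_strict (Nat.lt_add_one r₁)
          (lam.up_left_mem (show r₁ + 1 ≤ r₂ by omega) le_rfl hmem)
        have := T.col_strict (show r₁ + 1 < r₂ by omega) hmem
        omega
      have h3 : j < toggle T i r₁ := by
        refine lt_of_lt_of_le ?_ (toggleMin_le_toggle T i r₁)
        exact lt_of_lt_of_le (lt_rowCount_iff.2 ⟨hmem, by omega⟩) (le_max_right _ _)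
      have h4 : ¬ j < toggle T i (r₁ + 1) := by
        refine not_lt.2 ((toggle_le_toggleMax T i (r₁ + 1)).trans ((min_le_right _ _).trans ?_))
        exact not_lt.1 fun h => by
          have := (lt_rowCount_iff.1 h).2
          omega
      simp [benderKnuthEntry, hmem, hmem₁, h1, h2, h3, h4]
    · rcases benderKnuthEntry_cases T i r₁ j with h1 | h1 <;>
        rcases benderKnuthEntry_cases T i r₂ j with h2 | h2 <;> omega
  zeros' {r j} hmem := by
    simp [benderKnuthEntry, hmem, T.zeros hmem]

theorem benderKnuth_apply (r j : ℕ) : benderKnuth T i r j = benderKnuthEntry T i r j := rfl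

theorem rowCount_benderKnuth_of_ne {k : ℕ} (hk : k ≠ i + 1) :
    rowCount (benderKnuth T i) k r = rowCount T k r := by
  refine eq_of_forall_lt_iff_nat fun j => ?_
  rw [lt_rowCount_iff, lt_rowCount_iff, benderKnuth_apply]
  refine and_congr_right fun _ => ?_
  rcases benderKnuthEntry_cases T i r j with h1 | h1 <;> omega

theorem rowCount_benderKnuth : rowCount (benderKnuth T i) (i + 1) r = toggle T i r := by
  refine eq_of_forall_lt_iff_nat fun j => ?_
  rw [lt_rowCount_iff, benderKnuth_apply, benderKnuthEntry]
  have h1 : j < rowCount T i r → j < toggle T i r := fun h =>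
    h.trans_le ((le_max_left _ _).trans (toggleMin_le_toggle T i r))
  have h2 : j < toggle T i r → j < rowCount T (i + 2) r := fun h =>
    h.trans_le ((toggle_le_toggleMax T i r).trans (toggleMax_le T i r))
  rw [lt_rowCount_iff] at h1 h2
  by_cases hmem : (r, j) ∈ lam
  · simp only [hmem, true_and] at h1 h2 ⊢
    split_ifs with h3 h4
    · exact iff_of_true (Nat.lt_succ_self i) h4
    · exact iff_of_false (lt_irrefl _) h4
    · constructor
      · exact fun h => h1 (by omega)
      · intro h
        have := h2 h
        omega
  · exact iff_of_false (fun h => hmem h.1) fun h => hmem (h2 h).1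

/-- The maximum for row `r` and the minimum for row `r + 1` involve the same two numbers, so
together they give their sum; one boundary term remains. -/
theorem sum_toggleMin_add_toggleMax (M : ℕ) :
    ∑ r ∈ Finset.range M, (toggleMin T i r + toggleMax T i r) + toggleMax T i M =
      ∑ r ∈ Finset.range M, rowCount T i r + ∑ r ∈ Finset.range (M + 1), rowCount T (i + 2) r := by
  induction M with
  | zero => simp [toggleMax]
  | succ M ih =>
    rw [Finset.sum_range_succ, Finset.sum_range_succ (rowCount T i),
      Finset.sum_range_succ (rowCount T (i + 2)), toggleMax]
    have : max (rowCount T i M) (rowCount T (i + 2) (M + 1)) +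
        min (rowCount T (i + 2) (M + 1)) (rowCount T i M) =
          rowCount T i M + rowCount T (i + 2) (M + 1) := by
      rw [min_comm, max_add_min]
    rw [toggleMin]
    omega

theorem sum_toggle :
    ∑ r ∈ Finset.range (lam.colLen 0), toggle T i r +
        ∑ r ∈ Finset.range (lam.colLen 0), rowCount T (i + 1) r =
      ∑ r ∈ Finset.range (lam.colLen 0), rowCount T i r +
        ∑ r ∈ Finset.range (lam.colLen 0), rowCount T (i + 2) r := by
  have h := sum_toggleMin_add_toggleMax T i (lam.colLen 0)
  have h0 := toggleMax_le T i (lam.colLen 0)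
  rw [Finset.sum_range_succ (rowCount T (i + 2)), rowCount_colLen] at h
  rw [rowCount_colLen] at h0
  rw [← Finset.sum_add_distrib, Finset.sum_congr rfl fun r _ => toggle_add T i r]
  omega

/-- Only the count of letters below `i + 1` changes; `sum_toggle` reflects it between the counts
below `i` and below `i + 2`, which exchanges the two multiplicities. -/
theorem benderKnuth_mem_tab {T : SemistandardYoungTableau lam} {wt : ℕ → ℕ} (hT : T ∈ tab lam wt) :
    benderKnuth T i ∈ tab lam (wt ∘ Equiv.swap i (i + 1)) := by
  have hne : ∀ k, k ≠ i + 1 →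
      (lam.cells.filter fun c => benderKnuth T i c.1 c.2 < k).card =
        (lam.cells.filter fun c => T c.1 c.2 < k).card := fun k hk => by
    rw [card_filter_lt_eq_sum_rowCount, card_filter_lt_eq_sum_rowCount]
    exact Finset.sum_congr rfl fun r _ => rowCount_benderKnuth_of_ne T i r hk
  have heq : (lam.cells.filter fun c => benderKnuth T i c.1 c.2 < i + 1).card +
      (lam.cells.filter fun c => T c.1 c.2 < i + 1).card =
        (lam.cells.filter fun c => T c.1 c.2 < i).card +
          (lam.cells.filter fun c => T c.1 c.2 < i + 2).card := by
    simp only [card_filter_lt_eq_sum_rowCount, rowCount_benderKnuth]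
    exact sum_toggle T i
  have hs := card_filter_lt_succ T
  have hs' := card_filter_lt_succ (benderKnuth T i)
  have h1 := hne i (by omega)
  have h2 := hne (i + 2) (by omega)
  have e1 := hs i
  have e2 : _ = _ + _ := hs (i + 1)
  have e1' := hs' i
  have e2' : _ = _ + _ := hs' (i + 1)
  rw [show i + 1 + 1 = i + 2 from rfl] at e2 e2'
  intro j
  rw [Function.comp_apply]
  rcases eq_or_ne j i with rfl | hj
  · rw [Equiv.swap_apply_left, ← hT]
    omega
  rcases eq_or_ne j (i + 1) with rfl | hj'
  · rw [Equiv.swap_apply_right, ← hT]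
    omega
  · rw [Equiv.swap_apply_of_ne_of_ne hj hj', ← hT]
    have a := hs j
    have a' := hs' j
    have c := hne j hj'
    have d := hne (j + 1) (by omega)
    omega

/-- The neighbouring levels are unchanged, so the interval of reflection is known and the reflected
coordinate can be recovered. -/
theorem benderKnuth_injective : Function.Injective fun T : SemistandardYoungTableau lam =>
    benderKnuth T i := by
  intro T T' (h : benderKnuth T i = benderKnuth T' i)
  have hne : ∀ k, k ≠ i + 1 → ∀ r, rowCount T k r = rowCount T' k r := fun k hk r => by
    rw [← rowCount_benderKnuth_of_ne T i r hk, h, rowCount_benderKnuth_of_ne T' i r hk]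
  refine eq_of_rowCount_eq fun k r => ?_
  rcases eq_or_ne k (i + 1) with rfl | hk
  · have h1 : toggle T i r = toggle T' i r := by
      rw [← rowCount_benderKnuth, h, rowCount_benderKnuth]
    have h2 : toggleMin T i r = toggleMin T' i r := by
      rw [toggleMin, toggleMin, hne i (by omega), hne (i + 2) (by omega)]
    have h3 : toggleMax T i r = toggleMax T' i r := by
      cases r <;> simp only [toggleMax, hne i (by omega), hne (i + 2) (by omega)]
    have h4 := toggle_add T i r
    have h5 := toggle_add T' i r
    omega
  · exact hne k hk r

theorem kostka_le_kostka_comp_swap (lam : YoungDiagram) (wt : ℕ → ℕ) (i : ℕ) :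
    kostka lam wt ≤ kostka lam (wt ∘ Equiv.swap i (i + 1)) := by
  refine Finset.card_le_card_of_injOn (fun T => benderKnuth T i) (fun T hT => ?_)
    (benderKnuth_injective i).injOn
  have hT : T ∈ tab lam wt := (Set.Finite.mem_toFinset _).1 hT
  exact (Set.Finite.mem_toFinset _).2 (benderKnuth_mem_tab i hT)

theorem kostka_comp_swap (lam : YoungDiagram) (wt : ℕ → ℕ) (i : ℕ) :
    kostka lam (wt ∘ Equiv.swap i (i + 1)) = kostka lam wt := by
  have h := kostka_le_kostka_comp_swap lam (wt ∘ Equiv.swap i (i + 1)) i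
  have hinv : (wt ∘ Equiv.swap i (i + 1)) ∘ Equiv.swap i (i + 1) = wt := funext fun j => by simp
  rw [hinv] at h
  exact le_antisymm h (kostka_le_kostka_comp_swap lam wt i)

end BenderKnuth

/-- Kostka numbers are symmetric in the weight. -/
theorem kostka_getD_of_perm (lam : YoungDiagram) {l₁ l₂ : List ℕ} (h : l₁.Perm l₂) :
    kostka lam (fun j => l₁.getD j 0) = kostka lam fun j => l₂.getD j 0 := by
  -- An arbitrary prefix `p` lets the `cons` case absorb its head, so that a swap acts at positions
  -- `p.length` and `p.length + 1`.
  suffices ∀ p : List ℕ, kostka lam (fun j => (p ++ l₁).getD j 0) =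
      kostka lam fun j => (p ++ l₂).getD j 0 from this []
  induction h with
  | nil => exact fun _ => rfl
  | cons a _ ih =>
    intro p
    simpa using ih (p ++ [a])
  | swap a b l =>
    intro p
    rw [← kostka_comp_swap lam _ p.length]
    congr 1
    ext j
    rw [Function.comp_apply]
    rcases eq_or_ne j p.length with rfl | hj
    · simp
    rcases eq_or_ne j (p.length + 1) with rfl | hj'
    · simp
    · rw [Equiv.swap_apply_of_ne_of_ne hj hj']
      rcases lt_or_ge j p.length with hlt | hge
      · rw [List.getD_append _ _ _ _ hlt, List.getD_append _ _ _ _ hlt]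
      · obtain ⟨m, rfl⟩ : ∃ m, j = p.length + (m + 2) := ⟨j - p.length - 2, by omega⟩
        rw [List.getD_append_right _ _ _ _ hge, List.getD_append_right _ _ _ _ hge]
        simp
  | trans _ _ ih₁ ih₂ => exact fun p => (ih₁ p).trans (ih₂ p)

end CrystalKostka
end

/-! ### Compositions as subsets, and the expansion of the generating function. -/

noncomputable section
namespace CrystalKostka

/-! ### Compositions and subsets -/

section Compositions

variable {n : ℕ}

/-- The number of elements of `S` below `p`: the block of `p`, if the elements of `S` are the last
elements of the blocks but the last one. -/
def blockIndex (S : Finset (Fin n)) (p : ℕ) : ℕ :=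
  (S.filter fun i : Fin n => (i : ℕ) < p).card

theorem monotone_blockIndex (S : Finset (Fin n)) : Monotone (blockIndex S) := fun p q h =>
  Finset.card_le_card fun i hi => by
    rw [Finset.mem_filter] at hi ⊢
    exact ⟨hi.1, hi.2.trans_le h⟩

theorem blockIndex_eq_succ_iff (S : Finset (Fin n)) (i : Fin n) :
    blockIndex S i = blockIndex S (i + 1) ↔ i ∉ S := by
  have hsub : (S.filter fun j : Fin n => (j : ℕ) < i) ⊆
      S.filter fun j : Fin n => (j : ℕ) < i + 1 := fun j hj => by
    rw [Finset.mem_filter] at hj ⊢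
    exact ⟨hj.1, hj.2.trans (Nat.lt_succ_self _)⟩
  constructor
  · intro h hi
    have heq := Finset.eq_of_subset_of_card_le hsub h.ge
    have : i ∈ S.filter fun j : Fin n => (j : ℕ) < i :=
      heq ▸ Finset.mem_filter.2 ⟨hi, Nat.lt_succ_self _⟩
    exact lt_irrefl _ (Finset.mem_filter.1 this).2
  · intro hi
    refine congrArg Finset.card (Finset.Subset.antisymm hsub fun j hj => ?_)
    rw [Finset.mem_filter] at hj ⊢
    refine ⟨hj.1, lt_of_le_of_ne (Nat.lt_succ_iff.1 hj.2) fun h => hi ?_⟩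
    rw [← Fin.ext h]
    exact hj.1

theorem descentsInBlocks_blockIndex_iff {lam : YoungDiagram} (S : Finset (Fin n))
    (T : SemistandardYoungTableau lam) :
    DescentsInBlocks (n + 1) (blockIndex S) T ↔ ∀ i : Fin n, i ∉ S → IsDescent T i := by
  constructor
  · exact fun h i hi => h i (by omega) ((blockIndex_eq_succ_iff S i).2 hi)
  · exact fun h p hp hb => h ⟨p, by omega⟩ ((blockIndex_eq_succ_iff S ⟨p, by omega⟩).1 hb)

variable (I : Composition (n + 1))

theorem sizeUpTo_lt_iff {j k : ℕ} (hk : k ≤ I.length) :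
    I.sizeUpTo j < I.sizeUpTo k ↔ j < k := by
  constructor
  · exact fun h => not_le.1 fun h' => absurd (I.monotone_sizeUpTo h') (not_le.2 h)
  · exact fun h => (I.sizeUpTo_strict_mono (h.trans_le hk)).trans_le (I.monotone_sizeUpTo h)

theorem partialSumIdx_injective : Function.Injective (partialSumIdx I) := by
  intro k l h
  have h1 : I.sizeUpTo (k + 1) - 1 = I.sizeUpTo (l + 1) - 1 := congrArg Fin.val h
  have hk := partialSum_lt I k
  have hl := partialSum_lt I l
  have e1 := sizeUpTo_lt_iff I (j := k + 1) (k := l + 1) (by omega)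
  have e2 := sizeUpTo_lt_iff I (j := l + 1) (k := k + 1) (by omega)
  exact Fin.ext (by omega)

/-- The set of the partial sums of a composition. -/
def partialSums : Finset (Fin n) :=
  Finset.univ.image (partialSumIdx I)

theorem prod_partialSumIdx {M : Type*} [CommMonoid M] (f : Fin n → M) :
    ∏ k, f (partialSumIdx I k) = ∏ i ∈ partialSums I, f i :=
  (Finset.prod_image (partialSumIdx_injective I).injOn).symm

/-- Elements of `partialSums I` are partial sums minus one, so being below `p` means that the
partial sum is at most `p`; the number of these is the index of the block containing `p`. -/
theorem blockIndex_partialSums (p : Fin (n + 1)) :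
    blockIndex (partialSums I) p = I.index p := by
  have h1 := I.sizeUpTo_index_le p
  have h2 : (p : ℕ) < I.sizeUpTo (I.index p + 1) := I.lt_sizeUpTo_index_succ p
  have hlen := (I.index p).2
  rw [blockIndex, partialSums, Finset.filter_image,
    Finset.card_image_of_injective _ (partialSumIdx_injective I)]
  have : (Finset.univ.filter fun k => (partialSumIdx I k : ℕ) < p) =
      Finset.univ.filter fun k : Fin (I.length - 1) => (k : ℕ) < I.index p := by
    refine Finset.filter_congr fun k _ => ?_
    have hk := partialSum_lt I k
    have hkl := k.2
    rw [partialSumIdx]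
    change I.sizeUpTo (k + 1) - 1 < (p : ℕ) ↔ _
    constructor
    · intro h
      have := (sizeUpTo_lt_iff I (j := k + 1) (k := I.index p + 1) (by omega)).1
        (by omega)
      omega
    · intro h
      have := I.monotone_sizeUpTo (show (k : ℕ) + 1 ≤ I.index p from h)
      omega
  rw [this, Fin.card_filter_val_lt]
  omega

theorem blockWeight_partialSums :
    blockWeight (n + 1) (blockIndex (partialSums I)) = fun j => I.blocks.getD j 0 := by
  funext j
  rw [blockWeight]
  rcases lt_or_ge j I.length with hj | hj
  · have : ((Finset.range (n + 1)).filter fun p => blockIndex (partialSums I) p = j) =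
        Finset.Ico (I.sizeUpTo j) (I.sizeUpTo (j + 1)) := by
      ext p
      rw [Finset.mem_filter, Finset.mem_range, Finset.mem_Ico]
      have key : ∀ hp : p < n + 1, blockIndex (partialSums I) p = I.index ⟨p, hp⟩ := fun hp =>
        blockIndex_partialSums I ⟨p, hp⟩
      constructor
      · rintro ⟨hp, rfl⟩
        rw [key hp]
        exact ⟨I.sizeUpTo_index_le ⟨p, hp⟩, I.lt_sizeUpTo_index_succ ⟨p, hp⟩⟩
      · rintro ⟨h1, h2⟩
        have hp : p < n + 1 := h2.trans_le (I.sizeUpTo_le _)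
        refine ⟨hp, ?_⟩
        have h3 : I.sizeUpTo (I.index ⟨p, hp⟩) ≤ p := I.sizeUpTo_index_le ⟨p, hp⟩
        have h4 : p < I.sizeUpTo (I.index ⟨p, hp⟩ + 1) := I.lt_sizeUpTo_index_succ ⟨p, hp⟩
        have hlen := (I.index ⟨p, hp⟩).2
        rw [key hp]
        have e1 := (sizeUpTo_lt_iff I (j := j) (k := I.index ⟨p, hp⟩ + 1) (by omega)).1 (by omega)
        have e2 := (sizeUpTo_lt_iff I (j := I.index ⟨p, hp⟩) (k := j + 1) (by omega)).1 (by omega)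
        omega
    rw [this, Nat.card_Ico, I.sizeUpTo_succ hj, List.getD_eq_getElem _ _ hj]
    omega
  · rw [List.getD_eq_default _ _ hj, Finset.card_eq_zero, Finset.filter_eq_empty_iff]
    intro p hp h
    have := blockIndex_partialSums I ⟨p, Finset.mem_range.1 hp⟩
    have hlen := (I.index ⟨p, Finset.mem_range.1 hp⟩).2
    change blockIndex (partialSums I) p = _ at this
    omega

/-- The block lengths recover the composition: parts are positive, so the default value 0 marks the
end of the list. -/
theorem partialSums_injective : Function.Injective (partialSums (n := n)) := by
  intro I J h
  have hget : ∀ j, I.blocks.getD j 0 = J.blocks.getD j 0 := fun j => by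
    rw [← congrFun (blockWeight_partialSums I) j, h, congrFun (blockWeight_partialSums J) j]
  have hlt : ∀ (K : Composition (n + 1)) (j : ℕ), j < K.blocks.length ↔ 0 < K.blocks.getD j 0 := by
    intro K j
    rcases lt_or_ge j K.blocks.length with hj | hj
    · rw [List.getD_eq_getElem _ _ hj]
      exact iff_of_true hj (K.blocks_pos' j hj)
    · rw [List.getD_eq_default _ _ hj]
      exact iff_of_false (not_lt.2 hj) (lt_irrefl _)
  have hlen : I.blocks.length = J.blocks.length :=
    eq_of_forall_lt_iff_nat fun j => by rw [hlt, hlt, hget]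
  refine Composition.ext (List.ext_getElem hlen fun j h1 h2 => ?_)
  rw [← List.getD_eq_getElem _ 0 h1, ← List.getD_eq_getElem _ 0 h2, hget]

theorem partialSums_bijective : Function.Bijective (partialSums (n := n)) := by
  rw [Fintype.bijective_iff_injective_and_card]
  -- Both sides have `2 ^ n` elements.
  exact ⟨partialSums_injective, by simp [composition_card]⟩

end Compositions

/-! ### The generating function -/

theorem kostka_partWeight (lam : YoungDiagram) {m : ℕ} {mu : Nat.Partition m} {I : Composition m}
    (hI : I ∈ rearrangements mu) :
    kostka lam (partWeight mu) = kostka lam fun j => I.blocks.getD j 0 := by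
  refine kostka_getD_of_perm lam (Multiset.coe_eq_coe.1 ?_)
  rw [Multiset.sort_eq, (Finset.mem_filter.1 hI).2]

/-- The sets of rearrangements are the fibres of `Nat.Partition.ofComposition`. -/
theorem sum_sum_rearrangements {M : Type*} [AddCommMonoid M] {m : ℕ} (f : Composition m → M) :
    ∑ mu : Nat.Partition m, ∑ I ∈ rearrangements mu, f I = ∑ I, f I := by
  rw [← Finset.sum_fiberwise Finset.univ (Nat.Partition.ofComposition m) f]
  refine Finset.sum_congr rfl fun mu _ => Finset.sum_congr ?_ fun _ _ => rfl
  refine Finset.filter_congr fun I _ => ⟨fun h => Nat.Partition.ext h, ?_⟩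
  rintro rfl
  rfl

theorem one_sub_ratX_ne_zero {n : ℕ} (i : Fin n) : 1 - ratX i ≠ 0 := by
  rw [sub_ne_zero, ratX, ← map_one (algebraMap (MvPolynomial (Fin n) ℚ) (RatFun n))]
  intro h
  have h1 := IsFractionRing.injective (MvPolynomial (Fin n) ℚ) (RatFun n) h
  have h2 := congrArg (MvPolynomial.eval 0) h1
  simp at h2

open Classical in
theorem prod_pow_exponent_div {n : ℕ} {lam : YoungDiagram} {T : SemistandardYoungTableau lam}
    (hT : T ∈ tab lam (rectWeight 1 (n + 1))) :
    (∏ i : Fin n, ratX i ^ exponent (i : ℕ) T) / ∏ i : Fin n, (1 - ratX i) =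
      ∑ S : Finset (Fin n),
        if ∀ i : Fin n, i ∉ S → IsDescent T i then ∏ i ∈ S, ratT i else 0 := by
  have hfac : ∀ i : Fin n, ratX i ^ exponent (i : ℕ) T / (1 - ratX i) =
      ratT i + if IsDescent T i then 1 else 0 := fun i => by
    have h0 := one_sub_ratX_ne_zero i
    rw [exponent_eq_ite hT (by omega), ratT]
    split_ifs
    · field_simp
      ring
    · rw [pow_one, add_zero]
  -- In the expanded product `S` collects the factors where `t_i` is chosen; each remaining factor
  -- is 1 or 0 according to whether `i` is a descent.
  rw [← Finset.prod_div_distrib, Finset.prod_congr rfl fun i _ => hfac i, Finset.prod_add,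
    Finset.powerset_univ]
  refine Finset.sum_congr rfl fun S _ => ?_
  rw [Finset.prod_ite_zero, Finset.prod_const_one, mul_ite, mul_one, mul_zero]
  simp

open Classical in
theorem multiKostka_div_eq_sum (n : ℕ) (lam : YoungDiagram) (hlam : lam.card = n + 1) :
    algebraMap (MvPolynomial (Fin n) ℚ) (RatFun n) (multiKostka n 1 lam) /
        ∏ i : Fin n, (1 - ratX i) =
      ∑ S : Finset (Fin n), (kostka lam.transpose (blockWeight (n + 1) (blockIndex S)) : RatFun n) *
        ∏ i ∈ S, ratT i := by
  have hterm : ∀ T ∈ (tab_finite lam (rectWeight 1 (n + 1))).toFinset,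
      algebraMap (MvPolynomial (Fin n) ℚ) (RatFun n)
          (∏ i : Fin n, MvPolynomial.X i ^ exponent (i : ℕ) T) / ∏ i : Fin n, (1 - ratX i) =
        ∑ S : Finset (Fin n),
          if DescentsInBlocks (n + 1) (blockIndex S) T then ∏ i ∈ S, ratT i else 0 := by
    intro T hT
    simp only [descentsInBlocks_blockIndex_iff, map_prod, map_pow]
    exact prod_pow_exponent_div ((Set.Finite.mem_toFinset _).1 hT)
  rw [multiKostka, map_sum, Finset.sum_div, Finset.sum_congr rfl hterm, Finset.sum_comm]
  refine Finset.sum_congr rfl fun S _ => ?_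
  rw [← Finset.sum_filter, Finset.sum_const, nsmul_eq_mul, ← hlam,
    ← card_descentsInBlocks lam (monotone_blockIndex S)]

end CrystalKostka
end

theorem mainTheorem4 (n : ℕ) (lam : YoungDiagram) (hlam : lam.card = n + 1) :
    algebraMap (MvPolynomial (Fin n) ℚ) (CrystalKostka.RatFun n)
        (CrystalKostka.multiKostka n 1 lam) / ∏ i : Fin n, (1 - CrystalKostka.ratX i)
      = ∑ mu : Nat.Partition (n + 1),
          (CrystalKostka.kostka lam.transpose (CrystalKostka.partWeight mu) :
              CrystalKostka.RatFun n) *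
            ∑ I ∈ CrystalKostka.rearrangements mu,
              ∏ k : Fin (I.length - 1), CrystalKostka.ratT (CrystalKostka.partialSumIdx I k) := by
  open CrystalKostka in
  rw [multiKostka_div_eq_sum n lam hlam, ← partialSums_bijective.sum_comp, ← sum_sum_rearrangements]
  refine Finset.sum_congr rfl fun mu _ => ?_
  rw [Finset.mul_sum]
  refine Finset.sum_congr rfl fun I hI => ?_
  rw [blockWeight_partialSums, kostka_partWeight _ hI, prod_partialSumIdx]
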